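/- Let $\alpha,\eta,\theta,R$ be real $N\times N$ matrices with $\alpha^{T}=\alpha>0$, $\eta^{T}=\eta\ge 0$, $\theta^{T}=-\theta$, $R^{T}=R\ge 0$, and let $N_R=\operatorname{rank}R>0$. On $H=\mathbb{C}^{2N}=\mathbb{C}^N\oplus\mathbb{C}^N$, with $K_p=\sqrt{\alpha}^{-1}$, $\Phi=\sqrt{\eta}\,K_p^{T}$, put $$\Omega=\begin{pmatrix}-2\mathrm{i}K_p\theta K_p^{T} & -\mathrm{i}\Phi^{T}\\ \mathrm{i}\Phi & 0\end{pmatrix},\qquad B=\begin{pmatrix}K_pRK_p^{T}&0\\0&0\end{pmatrix},\qquad A(\beta)=\Omega-\mathrm{i}\beta B\quad(\beta\ge 0),$$ the system operator of the dissipative Lagrangian system $\alpha\ddot Q+(2\theta+\beta R)\dot Q+\eta Q=0$. Let $\omega_{\max}$ be the largest eigenvalue of the Hermitian matrix $\Omega$, $b_{\min}$ the smallest nonzero eigenvalue of $B$, and $P_B^{\perp}$ the orthogonal projection onto $\operatorname{Ker}B$. Assume $N_R<N$ and $P_B^{\perp}\Omega P_B^{\perp}\ne 0$, and let $\rho_{\min}$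 be the smallest positive eigenvalue of $P_B^{\perp}\Omega P_B^{\perp}$. Define $$c(\beta)=\frac{2\omega_{\max}^2}{b_{\min}}\Bigl[\beta-\frac{2\omega_{\max}}{b_{\min}}\Bigr]^{-1}\ \Bigl(\beta>\frac{2\omega_{\max}}{b_{\min}}\Bigr),\qquad c^{-1}(y)=\frac{2\omega_{\max}^2}{b_{\min}}\,y^{-1}+\frac{2\omega_{\max}}{b_{\min}}\ (y>0).$$ For a complex number $\zeta$ let $Q_\zeta=\frac12\frac{|\operatorname{Re}\zeta|}{-\operatorname{Im}\zeta}$, with $Q_\zeta=+\infty$ if $\operatorname{Im}\zeta=0\neq\operatorname{Re}\zeta$ and $Q_0=0$. Write $D(\rho;r)$ for the closed disc of radius $r$ about $\rho$ in $\mathbb{C}$. Then $c$ is strictly decreasing on $(2\omega_{\max}/b_{\min},\infty)$, $c(\beta)\to 0$ as $\beta\to\infty$, and $\rho_{\min}/2\le\omega_{\max}/2$. For every $\beta>c^{-1}(\rho_{\min}/2)$ we have $\beta>2\omega_{\max}/b_{\min}$ and $\rho_{\min}-c(\beta)>\max\{c(\beta),\rho_{\min}/2\}$. Moreover, there are unique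 $A(\beta)$-invariant subspaces $H_{h\ell}(\beta),H_{\ell\ell}(\beta),H_{\ell\ell,0}(\beta),H_{\ell\ell,1}(\beta)$ with $H=H_{h\ell}(\beta)\oplus H_{\ell\ell}(\beta)$, $H_{\ell\ell}(\beta)=H_{\ell\ell,0}(\beta)\oplus H_{\ell\ell,1}(\beta)$ and $$\sigma(A(\beta)|_{H_{\ell\ell}(\beta)})=\sigma(A(\beta))\cap D(0;\omega_{\max}),\qquad \sigma(A(\beta)|_{H_{h\ell}(\beta)})=\sigma(A(\beta))\cap\bigcup_{0\ne b\in\sigma(B)}D(-\mathrm{i}\beta b;\omega_{\max}),$$ $$\sigma(A(\beta)|_{H_{\ell\ell,0}(\beta)})=\sigma(A(\beta))\cap D(0;c(\beta)),\qquad \sigma(A(\beta)|_{H_{\ell\ell,1}(\beta)})=\sigma(A(\beta))\cap\bigcup_{0\neq\rho\in\sigma(P_B^{\perp}\Omega P_B^{\perp})}D(\rho;c(\beta)),$$ and for these subspaces $$\sigma(A(\beta)|_{H_{\ell\ell,0}(\beta)})=\{\zeta\in\sigma(A(\beta)):0\le-\operatorname{Im}\zeta\le c(\beta)\text{ and }|\operatorname{Re}\zeta|\le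 c(\beta)\},$$ $$\sigma(A(\beta)|_{H_{\ell\ell,1}(\beta)})=\{\zeta\in\sigma(A(\beta)):0\le-\operatorname{Im}\zeta\le c(\beta)\text{ and }|\operatorname{Re}\zeta|\ge\rho_{\min}-c(\beta)\},$$ $$\min_{\zeta\in\sigma(A(\beta)|_{H_{\ell\ell,1}(\beta)})}Q_\zeta\ \ge\ \frac12\,\frac{\rho_{\min}-c(\beta)}{c(\beta)}\ >\ \frac14\,\frac{\rho_{\min}}{c(\beta)}\ \ge\ \frac12 ,$$ where the minimum is attained (the set is nonempty). In particular $\operatorname{Re}\zeta\ne 0$ for every $\zeta\in\sigma(A(\beta)|_{H_{\ell\ell,1}(\beta)})$. Consequently these modes are underdamped: if $\zeta(\beta)\in\sigma(A(\beta)|_{H_{\ell\ell,1}(\beta)})$ for all sufficiently large $\beta$, then there is $\beta'\ge0$ with $\operatorname{Re}\zeta(\beta)\neq0$ for all $\beta>\beta'$. -/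

import Mathlib

open scoped MatrixOrder

noncomputable section

/-- The data of a dissipative Lagrangian system
`α Q'' + (2 θ + β R) Q' + η Q = 0` with `N` degrees of freedom: real `N × N` matrices with
`α` symmetric positive definite, `η` and `R` symmetric positive semidefinite,
`θ` skew-symmetric, and `R` of positive rank. -/
structure LagrangianSystem (N : ℕ) where
  α : Matrix (Fin N) (Fin N) ℝ
  η : Matrix (Fin N) (Fin N) ℝ
  θ : Matrix (Fin N) (Fin N) ℝ
  R : Matrix (Fin N) (Fin N) ℝ
  posDef_α : α.PosDef
  posSemidef_η : η.PosSemidef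
  transpose_θ : θ.transpose = -θ
  posSemidef_R : R.PosSemidef
  rank_R_pos : 0 < R.rank

namespace LagrangianSystem

variable {N : ℕ} (S : LagrangianSystem N)

/-- The space `H = ℂ^{2N} = ℂ^N ⊕ ℂ^N` with its standard inner product. -/
abbrev Space (N : ℕ) : Type := EuclideanSpace ℂ (Fin N ⊕ Fin N)

/-- `K_p = (√α)⁻¹`. -/
def Kp : Matrix (Fin N) (Fin N) ℝ := (CFC.sqrt S.α)⁻¹

/-- `K_q = √η`. -/
def Kq : Matrix (Fin N) (Fin N) ℝ := CFC.sqrt S.η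

/-- `Φ = K_q K_pᵀ`. -/
def Phi : Matrix (Fin N) (Fin N) ℝ := S.Kq * S.Kp.transpose

/-- `Ω_p = -2 i K_p θ K_pᵀ`. -/
def OmegaP : Matrix (Fin N) (Fin N) ℂ :=
  (-2 * Complex.I) • (S.Kp * S.θ * S.Kp.transpose).map Complex.ofReal

/-- `R̃ = K_p R K_pᵀ`. -/
def Rtilde : Matrix (Fin N) (Fin N) ℝ := S.Kp * S.R * S.Kp.transpose

/-- The frequency operator `Ω = [[Ω_p, -i Φᵀ], [i Φ, 0]]`. -/
def Omega : Matrix (Fin N ⊕ Fin N) (Fin N ⊕ Fin N) ℂ :=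
  Matrix.fromBlocks S.OmegaP ((-Complex.I) • S.Phi.transpose.map Complex.ofReal)
    (Complex.I • S.Phi.map Complex.ofReal) 0

/-- The dissipation operator `B = [[R̃, 0], [0, 0]]`. -/
def B : Matrix (Fin N ⊕ Fin N) (Fin N ⊕ Fin N) ℂ :=
  Matrix.fromBlocks (S.Rtilde.map Complex.ofReal) 0 0 0

/-- `Ω` as an operator on `H`. -/
def opOmega : Module.End ℂ (Space N) := Matrix.toEuclideanLin S.Omega

/-- `B` as an operator on `H`. -/
def opB : Module.End ℂ (Space N) := Matrix.toEuclideanLin S.B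

/-- The system operator `A(β) = Ω - i β B` on `H`. -/
def opA (β : ℝ) : Module.End ℂ (Space N) := S.opOmega - (Complex.I * (β : ℂ)) • S.opB

/-- The orthogonal projection `P_B^⊥` of `H` onto `Ker B`. -/
def projKerB : Module.End ℂ (Space N) :=
  ((LinearMap.ker S.opB).starProjection : Space N →L[ℂ] Space N).toLinearMap

/-- The compressed operator `P_B^⊥ Ω P_B^⊥`. -/
def compOmega : Module.End ℂ (Space N) := S.projKerB * S.opOmega * S.projKerB

/-- `ω_max`, the largest eigenvalue of (the Hermitian matrix) `Ω`. -/
def omegaMax : ℝ := sSup {ω : ℝ | (ω : ℂ) ∈ spectrum ℂ S.opOmega}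

/-- `b_min`, the smallest nonzero eigenvalue of (the positive semidefinite matrix) `B`. -/
def bMin : ℝ := sInf {b : ℝ | b ≠ 0 ∧ (b : ℂ) ∈ spectrum ℂ S.opB}

/-- `ρ_min`, the smallest positive eigenvalue of `P_B^⊥ Ω P_B^⊥`; it is meaningful when this
operator is nonzero. -/
def rhoMin : ℝ := sInf {ρ : ℝ | 0 < ρ ∧ (ρ : ℂ) ∈ spectrum ℂ S.compOmega}

/-- The function `c(β) = (2 ω_max² / b_min) (β - 2 ω_max / b_min)⁻¹`, used for
`β > 2 ω_max / b_min`. -/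
def c (β : ℝ) : ℝ :=
  (2 * S.omegaMax ^ 2 / S.bMin) * (β - 2 * S.omegaMax / S.bMin)⁻¹

/-- The inverse function `c⁻¹(y) = (2 ω_max² / b_min) y⁻¹ + 2 ω_max / b_min`, used for `y > 0`. -/
def cInv (y : ℝ) : ℝ :=
  (2 * S.omegaMax ^ 2 / S.bMin) * y⁻¹ + 2 * S.omegaMax / S.bMin

/-- `σ_0(A(β))`: the part of `σ(A(β))` in the closed disc of radius `ω_max` about `0`. -/
def sigma0 (β : ℝ) : Set ℂ :=
  spectrum ℂ (S.opA β) ∩ Metric.closedBall 0 S.omegaMax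

/-- `σ_1(A(β))`: the part of `σ(A(β))` in the union of the closed discs of radius `ω_max` about
the nonzero eigenvalues `-i β b` of `-i β B`. -/
def sigma1 (β : ℝ) : Set ℂ :=
  spectrum ℂ (S.opA β) ∩
    ⋃ b ∈ spectrum ℂ S.opB \ {0}, Metric.closedBall (-(Complex.I * (β : ℂ) * b)) S.omegaMax

/-- Subspaces `H_hℓ(β)`, `H_ℓℓ(β)`, `H_ℓℓ,0(β)`, `H_ℓℓ,1(β)` invariant under `A(β)` that form the
modal dichotomy:
`H = H_hℓ ⊕ H_ℓℓ`, `σ(A|H_ℓℓ) = σ_0(A)`, `σ(A|H_hℓ) = σ_1(A)`,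
`H_ℓℓ = H_ℓℓ,0 ⊕ H_ℓℓ,1`, `σ(A|H_ℓℓ,0) = σ(A) ∩ D(0; c(β))` and
`σ(A|H_ℓℓ,1) = σ(A) ∩ ⋃ D(ρ; c(β))` over the nonzero eigenvalues `ρ` of `P_B^⊥ Ω P_B^⊥`. -/
@[ext]
structure ModalDichotomy (β : ℝ) where
  Hhl : Submodule ℂ (Space N)
  Hll : Submodule ℂ (Space N)
  Hll0 : Submodule ℂ (Space N)
  Hll1 : Submodule ℂ (Space N)
  inv_hl : ∀ x ∈ Hhl, S.opA β x ∈ Hhl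
  inv_ll : ∀ x ∈ Hll, S.opA β x ∈ Hll
  inv_ll0 : ∀ x ∈ Hll0, S.opA β x ∈ Hll0
  inv_ll1 : ∀ x ∈ Hll1, S.opA β x ∈ Hll1
  isCompl_hl_ll : IsCompl Hhl Hll
  spectrum_ll : spectrum ℂ ((S.opA β).restrict inv_ll) = S.sigma0 β
  spectrum_hl : spectrum ℂ ((S.opA β).restrict inv_hl) = S.sigma1 β
  disjoint_ll : Disjoint Hll0 Hll1
  sup_ll : Hll0 ⊔ Hll1 = Hll
  spectrum_ll0 : spectrum ℂ ((S.opA β).restrict inv_ll0) =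
    spectrum ℂ (S.opA β) ∩ Metric.closedBall 0 (S.c β)
  spectrum_ll1 : spectrum ℂ ((S.opA β).restrict inv_ll1) =
    spectrum ℂ (S.opA β) ∩ ⋃ ρ ∈ spectrum ℂ S.compOmega \ {0}, Metric.closedBall ρ (S.c β)

namespace ModalDichotomy

variable {S} {β : ℝ} (D : S.ModalDichotomy β)

/-- `σ(A(β)|H_ℓℓ,0(β))`. -/
def spec0 : Set ℂ := spectrum ℂ ((S.opA β).restrict D.inv_ll0)

/-- `σ(A(β)|H_ℓℓ,1(β))`. -/
def spec1 : Set ℂ := spectrum ℂ ((S.opA β).restrict D.inv_ll1)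

end ModalDichotomy

end LagrangianSystem

/-- The quality factor `Q_ζ = |Re ζ| / (2 (-Im ζ))`, with the conventions `Q_ζ = +∞` if
`Im ζ = 0` and `Re ζ ≠ 0`, and `Q_ζ = 0` if `ζ = 0`. -/
def qFactor (ζ : ℂ) : EReal :=
  if ζ = 0 then 0
  else if ζ.im = 0 then ⊤
  else ((1 / 2 * (|ζ.re| / (-ζ.im)) : ℝ) : EReal)

/-- A mode with time dependency `e^{-i ζ(β) t}` is underdamped if, for some `β' ≥ 0`, its
frequency `Re ζ(β)` is nonzero for all `β > β'`. -/
def IsUnderdamped (ζ : ℝ → ℂ) : Prop :=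
  ∃ β' : ℝ, 0 ≤ β' ∧ ∀ β, β' < β → (ζ β).re ≠ 0

end

/-! Write an eigenvector of `A(β)` with eigenvalue `z` as `x = u + y`, where `y` is its component in
`Ker B`. On the complement of `Ker B` the term `βB` is at least `β b_min`, so for large `β` and
moderate `z` the component of the eigenvalue equation there makes `u` small relative to `y`. The
component in `Ker B` then makes `y` an approximate eigenvector of the Hermitian compression of `Ω`,
which puts `z` within `c(β)` of a real eigenvalue of that compression
(`exists_near_mem_spectrum_compOmega`, `exists_near`). The cruder bound `‖Ωx‖ ≤ ω_max ‖x‖` separates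
the high-loss eigenvalues from the rest (`spectrum_opA_subset`, `le_neg_im_of_mem_sigma1`).

The estimate is uniform when the coupling between `Ker B` and its complement is scaled by `t ∈ [0,
1]`, and it is strict, so no eigenvalue crosses the boundary of the discs. Continuity of the
determinant (`exists_mem_spectrum_of_segment`) carries the eigenvalue `ρ_min` of the decoupled
operator to an eigenvalue of `A(β)` in the discs, which is the nonemptiness claim.

The subspaces are sums of generalized eigenspaces. They are unique because an invariant subspace
with prescribed spectrum lies in such a sum (`le_spectralSubspace`), and nested complementary pairs
coincide. The quality factor bound reads off `|Re ζ| ≥ ρ_min - c` and `|Im ζ| ≤ c` on the discs. -/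

noncomputable section

/-! ### Spectral subspaces of an operator in finite dimension. -/

namespace Module.End

variable {V : Type*} [AddCommGroup V] [Module ℂ V]

/-- The sum of the generalized eigenspaces of `T` with eigenvalues in `s`. -/
def spectralSubspace (T : Module.End ℂ V) (s : Set ℂ) : Submodule ℂ V :=
  ⨆ z ∈ s, T.maxGenEigenspace z

lemma spectralSubspace_invariant (T : Module.End ℂ V) (s : Set ℂ) :
    ∀ x ∈ T.spectralSubspace s, T x ∈ T.spectralSubspace s := by
  have h : T.spectralSubspace s ≤ (T.spectralSubspace s).comap T := by
    refine iSup₂_le fun z hz x hx ↦ ?_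
    exact Submodule.mem_iSup_of_mem z (Submodule.mem_iSup_of_mem hz
      (mapsTo_maxGenEigenspace_of_comm (Commute.refl T) z hx))
  exact h

lemma spectralSubspace_union (T : Module.End ℂ V) (s t : Set ℂ) :
    T.spectralSubspace (s ∪ t) = T.spectralSubspace s ⊔ T.spectralSubspace t :=
  iSup_union

lemma disjoint_spectralSubspace (T : Module.End ℂ V) {s t : Set ℂ} (h : Disjoint s t) :
    Disjoint (T.spectralSubspace s) (T.spectralSubspace t) :=
  T.independent_maxGenEigenspace.disjoint_biSup_biSup h

variable [FiniteDimensional ℂ V]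

/-- `W` is the sum of the generalized eigenspaces of the restriction, and each of these is trivial
or sits inside the one of `T`. This is the source of uniqueness. -/
lemma le_spectralSubspace (T : Module.End ℂ V) {s : Set ℂ} {W : Submodule ℂ V}
    (hW : ∀ x ∈ W, T x ∈ W) (hs : spectrum ℂ (T.restrict hW) ⊆ s) :
    W ≤ T.spectralSubspace s := by
  have h2 := congrArg (Submodule.map W.subtype)
    (iSup_maxGenEigenspace_eq_top (T.restrict hW))
  rw [Submodule.map_top, Submodule.range_subtype, Submodule.map_iSup] at h2
  rw [← h2]
  refine iSup_le fun z ↦ ?_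
  by_cases hz : z ∈ spectrum ℂ (T.restrict hW)
  · refine le_trans ?_ (le_iSup₂_of_le z (hs hz) le_rfl)
    unfold maxGenEigenspace
    rw [genEigenspace_restrict]
    exact Submodule.map_comap_le _ _
  · have : maxGenEigenspace (T.restrict hW) z = ⊥ := by
      by_contra hne
      exact hz (hasEigenvalue_iff_mem_spectrum.mp
        (HasUnifEigenvalue.lt (k := ⊤) zero_lt_one hne))
    simp [this]

lemma mem_spectrum_iff_exists (T : Module.End ℂ V) (z : ℂ) :
    z ∈ spectrum ℂ T ↔ ∃ x ≠ 0, T x = z • x := by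
  rw [← hasEigenvalue_iff_mem_spectrum]
  constructor
  · intro h
    obtain ⟨x, hx⟩ := h.exists_hasEigenvector
    exact ⟨x, hx.2, hx.apply_eq_smul⟩
  · rintro ⟨x, hx, h⟩
    exact hasEigenvalue_of_hasEigenvector ⟨mem_eigenspace_iff.mpr h, hx⟩

lemma spectrum_restrict_spectralSubspace (T : Module.End ℂ V) (s : Set ℂ) :
    spectrum ℂ (T.restrict (T.spectralSubspace_invariant s)) = spectrum ℂ T ∩ s := by
  ext z
  rw [Set.mem_inter_iff, mem_spectrum_iff_exists, mem_spectrum_iff_exists]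
  constructor
  · rintro ⟨⟨x, hxs⟩, hx0, hx⟩
    have hTx : T x = z • x := congrArg Subtype.val hx
    have hx0' : x ≠ 0 := fun h ↦ hx0 (Subtype.ext h)
    refine ⟨⟨x, hx0', hTx⟩, ?_⟩
    by_contra hz
    -- For `z ∉ s` the eigenvector would lie in two independent spectral subspaces.
    have hd := T.disjoint_spectralSubspace (Set.disjoint_singleton_left.mpr hz)
    refine hx0' (Submodule.disjoint_def.mp hd x ?_ hxs)
    exact Submodule.mem_iSup_of_mem z (Submodule.mem_iSup_of_mem rfl
      (eigenspace_le_maxGenEigenspace (mem_eigenspace_iff.mpr hTx)))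
  · rintro ⟨⟨x, hx0, hTx⟩, hz⟩
    refine ⟨⟨x, Submodule.mem_iSup_of_mem z (Submodule.mem_iSup_of_mem hz
      (eigenspace_le_maxGenEigenspace (mem_eigenspace_iff.mpr hTx)))⟩, ?_, Subtype.ext hTx⟩
    exact fun h ↦ hx0 (congrArg Subtype.val h)

lemma spectralSubspace_eq_top (T : Module.End ℂ V) {s : Set ℂ} (h : spectrum ℂ T ⊆ s) :
    T.spectralSubspace s = ⊤ := by
  rw [eq_top_iff, ← T.iSup_maxGenEigenspace_eq_top]
  refine iSup_le fun z ↦ ?_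
  by_cases hz : z ∈ spectrum ℂ T
  · exact le_iSup₂_of_le z (h hz) le_rfl
  · have : T.maxGenEigenspace z = ⊥ := by
      by_contra hne
      exact hz (hasEigenvalue_iff_mem_spectrum.mp
        (HasUnifEigenvalue.lt (k := ⊤) zero_lt_one hne))
    simp [this]

/-! ### Finiteness of the spectrum and persistence of eigenvalues along a segment. -/

lemma spectrum_finite (T : Module.End ℂ V) : (spectrum ℂ T).Finite := by
  have := T.finite_hasEigenvalue
  simp only [hasEigenvalue_iff_mem_spectrum] at this
  exact this

/-- Each linear factor of the characteristic polynomial at `z` has modulus at least `r`. Used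
contrapositively: a small determinant forces an eigenvalue within `r` of `z`. -/
lemma pow_finrank_le_norm_det (T : Module.End ℂ V) {z : ℂ} {r : ℝ} (hr : 0 ≤ r)
    (h : ∀ w ∈ spectrum ℂ T, r ≤ dist w z) :
    r ^ Module.finrank ℂ V ≤ ‖LinearMap.det (z • (1 : Module.End ℂ V) - T)‖ := by
  have hs := IsAlgClosed.splits T.charpoly
  have h1 : LinearMap.det (z • (1 : Module.End ℂ V) - T) = T.charpoly.eval z := by
    rw [LinearMap.eval_charpoly, Algebra.algebraMap_eq_smul_one]
  rw [h1, hs.eval_eq_prod_roots_of_monic T.charpoly_monic, ← T.charpoly_natDegree,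
    hs.natDegree_eq_card_roots]
  have h2 : ∀ m : Multiset ℂ, (∀ w ∈ m, r ≤ dist w z) →
      r ^ m.card ≤ ‖(m.map fun w ↦ z - w).prod‖ := by
    intro m
    induction m using Multiset.induction_on with
    | empty => simp
    | cons a m ih =>
      intro hm
      rw [Multiset.card_cons, Multiset.map_cons, Multiset.prod_cons, norm_mul, pow_succ']
      have ha := hm a (Multiset.mem_cons_self a m)
      rw [dist_comm, dist_eq_norm] at ha
      exact mul_le_mul ha (ih fun w hw ↦ hm w (Multiset.mem_cons_of_mem hw))
        (pow_nonneg hr _) (norm_nonneg _)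
  refine h2 _ fun w hw ↦ h w ?_
  rw [mem_spectrum_iff_isRoot_charpoly]
  exact Polynomial.isRoot_of_mem_roots hw

lemma mem_spectrum_iff_det (T : Module.End ℂ V) (z : ℂ) :
    z ∈ spectrum ℂ T ↔ LinearMap.det (z • (1 : Module.End ℂ V) - T) = 0 := by
  rw [mem_spectrum_iff_isRoot_charpoly, Polynomial.IsRoot, LinearMap.eval_charpoly,
    Algebra.algebraMap_eq_smul_one]

lemma continuous_det_line (D E : Module.End ℂ V) :
    Continuous fun p : ℝ × ℂ ↦
      LinearMap.det (p.2 • (1 : Module.End ℂ V) - (D + (p.1 : ℂ) • E)) := by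
  let b := Module.finBasis ℂ V
  have : ∀ p : ℝ × ℂ, LinearMap.det (p.2 • (1 : Module.End ℂ V) - (D + (p.1 : ℂ) • E)) =
      (p.2 • LinearMap.toMatrix b b (1 : Module.End ℂ V) -
        (LinearMap.toMatrix b b D + (p.1 : ℂ) • LinearMap.toMatrix b b E)).det := by
    intro p
    rw [← LinearMap.det_toMatrix b]
    simp only [map_sub, map_add, map_smul]
  simp_rw [this]
  apply Continuous.matrix_det
  fun_prop

/-- If along the segment `D + t E` no eigenvalue in the compact set `K` leaves the open set
`U ⊆ K`, then an eigenvalue in `K` at `t = 0` persists up to `t = 1`. -/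
lemma exists_mem_spectrum_of_segment (D E : Module.End ℂ V) {U K : Set ℂ} (hU : IsOpen U)
    (hK : IsCompact K) (hUK : U ⊆ K)
    (hloc : ∀ t ∈ Set.Icc (0 : ℝ) 1, spectrum ℂ (D + (t : ℂ) • E) ∩ K ⊆ U)
    (h0 : (spectrum ℂ D ∩ K).Nonempty) : (spectrum ℂ (D + E) ∩ K).Nonempty := by
  have hc := continuous_det_line D E
  let F : Set (Set.Icc (0 : ℝ) 1) := {t | (spectrum ℂ (D + ((t : ℝ) : ℂ) • E) ∩ K).Nonempty}
  -- `F` is the projection of a closed set along the compact factor `K`.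
  have hclosed : IsClosed F := by
    have : CompactSpace K := isCompact_iff_compactSpace.mp hK
    have hcl : IsClosed {p : Set.Icc (0 : ℝ) 1 × K |
        LinearMap.det ((p.2 : ℂ) • (1 : Module.End ℂ V) - (D + ((p.1 : ℝ) : ℂ) • E)) = 0} :=
      isClosed_singleton.preimage (hc.comp (f := fun p : Set.Icc (0 : ℝ) 1 × K ↦
        ((p.1 : ℝ), (p.2 : ℂ))) (by fun_prop))
    convert isClosedMap_fst_of_compactSpace _ hcl
    ext t
    constructor
    · rintro ⟨z, hz, hzK⟩
      exact ⟨(t, ⟨z, hzK⟩), (mem_spectrum_iff_det _ _).mp hz, rfl⟩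
    · rintro ⟨⟨t', z⟩, hz, rfl⟩
      exact ⟨z, (mem_spectrum_iff_det _ _).mpr hz, z.2⟩
  -- An eigenvalue at `t` has a ball inside `U`; for `s` near `t` the determinant at its centre is
  -- too small for the ball to be free of eigenvalues.
  have hopen : IsOpen F := by
    rw [isOpen_iff_mem_nhds]
    rintro t ⟨z, hz, hzK⟩
    obtain ⟨r, hr, hball⟩ := Metric.isOpen_iff.mp hU z (hloc t t.2 ⟨hz, hzK⟩)
    have hct : Continuous fun s : Set.Icc (0 : ℝ) 1 ↦
        ‖LinearMap.det (z • (1 : Module.End ℂ V) - (D + ((s : ℝ) : ℂ) • E))‖ :=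
      (hc.comp (f := fun s : Set.Icc (0 : ℝ) 1 ↦ ((s : ℝ), z)) (by fun_prop)).norm
    have hlt : ‖LinearMap.det (z • (1 : Module.End ℂ V) - (D + ((t : ℝ) : ℂ) • E))‖ <
        r ^ Module.finrank ℂ V := by
      rw [(mem_spectrum_iff_det _ _).mp hz, norm_zero]
      exact pow_pos hr _
    filter_upwards [hct.continuousAt.eventually_lt continuousAt_const hlt] with s hs
    by_contra hF
    refine absurd (pow_finrank_le_norm_det _ hr.le fun w hw ↦ ?_) (not_le.mpr hs)
    by_contra hd
    exact hF ⟨w, hw, hUK (hball (not_le.mp hd))⟩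
  have huniv : F = Set.univ := by
    refine (isClopen_iff.mp ⟨hclosed, hopen⟩).resolve_left (Set.Nonempty.ne_empty ?_)
    exact ⟨⟨0, by simp⟩, by simpa [F] using h0⟩
  have h1 : (⟨1, by simp⟩ : Set.Icc (0 : ℝ) 1) ∈ F := huniv ▸ Set.mem_univ _
  simpa [F] using h1

end Module.End

/-! ### Norm estimates for symmetric operators from their eigenvalues. -/

namespace LinearMap.IsSymmetric

variable {E : Type*} [NormedAddCommGroup E] [InnerProductSpace ℂ E] [FiniteDimensional ℂ E]
  {T : Module.End ℂ E}

open scoped InnerProductSpace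

lemma norm_sq_eq_sum (hT : LinearMap.IsSymmetric T) (x : E) :
    ‖x‖ ^ 2 = ∑ i, ‖⟪hT.eigenvectorBasis rfl i, x⟫_ℂ‖ ^ 2 :=
  ((hT.eigenvectorBasis rfl).sum_sq_norm_inner_right x).symm

lemma inner_eigenvectorBasis_apply (hT : LinearMap.IsSymmetric T) (x : E)
    (i : Fin (Module.finrank ℂ E)) :
    ⟪hT.eigenvectorBasis rfl i, T x⟫_ℂ =
      (hT.eigenvalues rfl i : ℂ) * ⟪hT.eigenvectorBasis rfl i, x⟫_ℂ := by
  rw [← hT, hT.apply_eigenvectorBasis, inner_smul_left]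
  simp

lemma eigenvalues_mem_spectrum (hT : LinearMap.IsSymmetric T) (i : Fin (Module.finrank ℂ E)) :
    (hT.eigenvalues rfl i : ℂ) ∈ spectrum ℂ T :=
  Module.End.hasEigenvalue_iff_mem_spectrum.mp (hT.hasEigenvalue_eigenvalues rfl i)

/-- Lower bound for `a T - ζ` on a vector whose components along the eigenvectors violating the
bound vanish. -/
lemma mul_norm_le_norm_smul_sub (hT : LinearMap.IsSymmetric T) (a z : ℂ) {d : ℝ} (hd : 0 ≤ d)
    (x : E) (h : ∀ (μ : ℝ) (v : E), (μ : ℂ) ∈ spectrum ℂ T → T v = (μ : ℂ) • v →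
      d ≤ ‖a * μ - z‖ ∨ ⟪v, x⟫_ℂ = 0) :
    d * ‖x‖ ≤ ‖a • T x - z • x‖ := by
  refine le_of_sq_le_sq ?_ (norm_nonneg _)
  rw [mul_pow, hT.norm_sq_eq_sum x, hT.norm_sq_eq_sum (a • T x - z • x), Finset.mul_sum]
  refine Finset.sum_le_sum fun i _ ↦ ?_
  rw [inner_sub_right, inner_smul_right, inner_smul_right, hT.inner_eigenvectorBasis_apply,
    ← mul_assoc, ← sub_mul, norm_mul, mul_pow]
  rcases h (hT.eigenvalues rfl i) (hT.eigenvectorBasis rfl i) (hT.eigenvalues_mem_spectrum i)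
    (hT.apply_eigenvectorBasis rfl i) with h | h
  · gcongr
  · simp [h]

lemma exists_mem_spectrum_norm_le (hT : LinearMap.IsSymmetric T) (a z : ℂ) {r : ℝ} (hr : 0 ≤ r)
    {x : E} (hx : x ≠ 0) (h : ‖a • T x - z • x‖ ≤ r * ‖x‖) :
    ∃ μ : ℝ, (μ : ℂ) ∈ spectrum ℂ T ∧ ‖a * μ - z‖ ≤ r := by
  by_contra! hcon
  have hxpos := norm_pos_iff.mpr hx
  have hfin : {μ : ℝ | (μ : ℂ) ∈ spectrum ℂ T}.Finite :=
    T.spectrum_finite.preimage Complex.ofReal_injective.injOn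
  -- Finiteness of the spectrum turns pointwise strictness into a uniform `d > r`; `r + 1` is a
  -- dummy value for an empty spectrum.
  obtain ⟨d, hrd, hd⟩ : ∃ d, r < d ∧ ∀ μ : ℝ, (μ : ℂ) ∈ spectrum ℂ T → d ≤ ‖a * μ - z‖ := by
    rcases hfin.toFinset.eq_empty_or_nonempty with he | hne
    · refine ⟨r + 1, by linarith, fun μ hμ ↦ ?_⟩
      have : μ ∈ hfin.toFinset := by simpa using hμ
      simp [he] at this
    · obtain ⟨m, hm, hmin⟩ := hfin.toFinset.exists_min_image (fun μ ↦ ‖a * (μ : ℂ) - z‖) hne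
      exact ⟨_, hcon m (by simpa using hm), fun μ hμ ↦ hmin μ (by simpa using hμ)⟩
  have := hT.mul_norm_le_norm_smul_sub a z (hr.trans hrd.le) x fun μ _ hμ _ ↦ Or.inl (hd μ hμ)
  nlinarith

lemma norm_apply_le (hT : LinearMap.IsSymmetric T) {M : ℝ} (hM : 0 ≤ M)
    (h : ∀ μ : ℝ, (μ : ℂ) ∈ spectrum ℂ T → |μ| ≤ M) (x : E) : ‖T x‖ ≤ M * ‖x‖ := by
  refine le_of_sq_le_sq ?_ (by positivity)
  rw [mul_pow, hT.norm_sq_eq_sum x, hT.norm_sq_eq_sum (T x), Finset.mul_sum]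
  refine Finset.sum_le_sum fun i _ ↦ ?_
  rw [hT.inner_eigenvectorBasis_apply, norm_mul, mul_pow]
  have := h _ (hT.eigenvalues_mem_spectrum i)
  gcongr
  simpa using this

lemma exists_ofReal_of_mem_spectrum (hT : LinearMap.IsSymmetric T) {z : ℂ}
    (hz : z ∈ spectrum ℂ T) : ∃ μ : ℝ, z = μ :=
  ⟨z.re, (Complex.conj_eq_iff_re.mp (hT.conj_eigenvalue_eq_self
    (Module.End.hasEigenvalue_iff_mem_spectrum.mpr hz))).symm⟩

lemma exists_ne_zero_mem_spectrum (hT : LinearMap.IsSymmetric T) (h : T ≠ 0) :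
    ∃ μ : ℝ, μ ≠ 0 ∧ (μ : ℂ) ∈ spectrum ℂ T := by
  by_contra! hcon
  refine h (LinearMap.ext fun x ↦ ?_)
  have := hT.norm_apply_le le_rfl (fun μ hμ ↦ by
    by_contra h0
    exact hcon μ (by rintro rfl; simp at h0) hμ) x
  simpa using this

end LinearMap.IsSymmetric

end

noncomputable section

namespace LagrangianSystem

open scoped InnerProductSpace

variable {N : ℕ} (S : LagrangianSystem N)

/-! ### Structure of the matrices -/

lemma omega_isHermitian : S.Omega.IsHermitian := by
  have hP : (S.Kp * S.θ * S.Kp.transpose).transpose = -(S.Kp * S.θ * S.Kp.transpose) := by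
    simp [Matrix.transpose_mul, S.transpose_θ, Matrix.mul_assoc]
  refine Matrix.IsHermitian.ext fun i j ↦ ?_
  rcases i with i | i <;> rcases j with j | j
  · have h := congrFun (congrFun hP i) j
    simp only [Matrix.transpose_apply, Matrix.neg_apply] at h
    simp [Omega, OmegaP, h]
  · simp [Omega]
  · simp [Omega]
  · simp [Omega]

/-- `Ω` is `i` times a real matrix. This makes its spectrum, and that of its compression, symmetric
about `0`. -/
lemma star_omega_apply (i j : Fin N ⊕ Fin N) : star (S.Omega i j) = -S.Omega i j := by
  rcases i with i | i <;> rcases j with j | j <;> simp [Omega, OmegaP]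

lemma star_B_apply (i j : Fin N ⊕ Fin N) : star (S.B i j) = S.B i j := by
  rcases i with i | i <;> rcases j with j | j <;> simp [B]

open scoped ComplexOrder in
-- A factorization `R = XᵀX` gives `B = Z* Z`, where `Z` has the single nonzero block `X K_pᵀ`.
lemma B_posSemidef : S.B.PosSemidef := by
  obtain ⟨X, hX⟩ := CStarAlgebra.nonneg_iff_eq_star_mul_self.mp S.posSemidef_R.nonneg
  have hX' : S.R = X.transpose * X := by
    rw [hX, Matrix.star_eq_conjTranspose, Matrix.conjTranspose_eq_transpose_of_trivial]
  let Y : Matrix (Fin N) (Fin N) ℂ := (X * S.Kp.transpose).map Complex.ofRealHom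
  have hB : S.B = (Matrix.fromBlocks Y 0 0 0).conjTranspose * Matrix.fromBlocks Y 0 0 0 := by
    have hY : Y.conjTranspose = (S.Kp * X.transpose).map Complex.ofRealHom := by
      ext i j
      simp [Y, Matrix.conjTranspose_apply, Matrix.mul_apply, mul_comm]
    have hR : S.Rtilde.map Complex.ofReal = Y.conjTranspose * Y := by
      rw [hY, ← Matrix.map_mul, Rtilde, hX']
      simp only [Matrix.mul_assoc]
      rfl
    rw [Matrix.fromBlocks_conjTranspose, Matrix.fromBlocks_multiply, B, hR]
    simp
  rw [hB]
  exact Matrix.posSemidef_conjTranspose_mul_self _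

/-- `K_p` is invertible, so a vanishing congruence `K_p R K_pᵀ` would force `R = 0`, against the
positive rank. -/
lemma B_ne_zero : S.B ≠ 0 := by
  intro h
  have hR : S.Rtilde = 0 := by
    ext i j
    have := congrFun (congrFun h (Sum.inl i)) (Sum.inl j)
    simpa [B] using this
  have hdet : IsUnit (CFC.sqrt S.α).det := by
    have hs : CFC.sqrt S.α * CFC.sqrt S.α = S.α :=
      CFC.sqrt_mul_sqrt_self _ S.posDef_α.posSemidef.nonneg
    have h1 := S.posDef_α.det_pos.ne'
    rw [← hs, Matrix.det_mul] at h1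
    exact (left_ne_zero_of_mul h1).isUnit
  have hK : CFC.sqrt S.α * S.Kp = 1 := Matrix.mul_nonsing_inv _ hdet
  have hKt : S.Kp.transpose * (CFC.sqrt S.α).transpose = 1 := by
    rw [← Matrix.transpose_mul, hK, Matrix.transpose_one]
  have : S.R = CFC.sqrt S.α * S.Rtilde * (CFC.sqrt S.α).transpose := by
    calc S.R = (CFC.sqrt S.α * S.Kp) * S.R * (S.Kp.transpose * (CFC.sqrt S.α).transpose) := by
          rw [hK, hKt]; simp
      _ = _ := by simp only [Rtilde, Matrix.mul_assoc]
  have hr := S.rank_R_pos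
  rw [this, hR] at hr
  simp at hr

lemma opOmega_isSymmetric : LinearMap.IsSymmetric S.opOmega :=
  Matrix.isSymmetric_toEuclideanLin_iff.mpr S.omega_isHermitian

open scoped ComplexOrder in
lemma opB_isPositive : LinearMap.IsPositive S.opB :=
  Matrix.isPositive_toEuclideanLin_iff.mpr S.B_posSemidef

lemma opB_isSymmetric : LinearMap.IsSymmetric S.opB := S.opB_isPositive.1

lemma opB_ne_zero : S.opB ≠ 0 := by
  simpa [opB] using S.B_ne_zero

/-! ### The projection onto the kernel of `B` -/

lemma opB_projKerB (x : Space N) : S.opB (S.projKerB x) = 0 :=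
  LinearMap.mem_ker.mp (Submodule.starProjection_apply_mem _ x)

lemma projKerB_of_opB_eq_zero {x : Space N} (h : S.opB x = 0) : S.projKerB x = x :=
  Submodule.starProjection_eq_self_iff.mpr (LinearMap.mem_ker.mpr h)

lemma projKerB_projKerB (x : Space N) : S.projKerB (S.projKerB x) = S.projKerB x :=
  S.projKerB_of_opB_eq_zero (S.opB_projKerB x)

lemma inner_sub_projKerB (x : Space N) {k : Space N} (hk : S.opB k = 0) :
    ⟪x - S.projKerB x, k⟫_ℂ = 0 :=
  Submodule.starProjection_inner_eq_zero x k (LinearMap.mem_ker.mpr hk)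

lemma projKerB_isSymmetric : LinearMap.IsSymmetric S.projKerB :=
  Submodule.starProjection_isSymmetric _

lemma projKerB_eq {x y : Space N} (hy : S.opB y = 0)
    (h : ∀ k, S.opB k = 0 → ⟪x - y, k⟫_ℂ = 0) : S.projKerB x = y :=
  Submodule.eq_starProjection_of_mem_of_inner_eq_zero (LinearMap.mem_ker.mpr hy)
    fun k hk ↦ h k (LinearMap.mem_ker.mp hk)

lemma projKerB_opB (x : Space N) : S.projKerB (S.opB x) = 0 := by
  refine S.projKerB_eq (map_zero _) fun k hk ↦ ?_
  rw [sub_zero, S.opB_isSymmetric, hk, inner_zero_right]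

lemma norm_projKerB_le (x : Space N) : ‖S.projKerB x‖ ≤ ‖x‖ :=
  Submodule.norm_starProjection_apply_le _ x

lemma norm_sub_projKerB_le (x : Space N) : ‖x - S.projKerB x‖ ≤ ‖x‖ := by
  have := Submodule.norm_starProjection_apply_le (LinearMap.ker S.opB)ᗮ x
  rwa [Submodule.starProjection_orthogonal_val] at this

lemma compOmega_apply (x : Space N) :
    S.compOmega x = S.projKerB (S.opOmega (S.projKerB x)) := rfl

lemma compOmega_isSymmetric : LinearMap.IsSymmetric S.compOmega := fun x y ↦ by
  rw [compOmega_apply, compOmega_apply, S.projKerB_isSymmetric, S.opOmega_isSymmetric,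
    S.projKerB_isSymmetric]

/-! ### Complex conjugation and the symmetry of the spectra -/

/-- Coordinatewise complex conjugation. -/
def conjSpace (x : Space N) : Space N := WithLp.toLp 2 (star x.ofLp)

lemma conjSpace_apply (x : Space N) (i : Fin N ⊕ Fin N) : conjSpace x i = star (x i) := rfl

lemma conjSpace_ne_zero {x : Space N} (hx : x ≠ 0) : conjSpace x ≠ 0 := by
  intro h
  refine hx ?_
  ext i
  have := congrArg (fun y : Space N ↦ y i) h
  simpa [conjSpace_apply] using this

lemma inner_conjSpace (x y : Space N) : ⟪conjSpace x, y⟫_ℂ = star ⟪x, conjSpace y⟫_ℂ := by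
  simp [PiLp.inner_apply, conjSpace_apply, mul_comm]

lemma conjSpace_sub (x y : Space N) : conjSpace (x - y) = conjSpace x - conjSpace y := by
  ext i; simp [conjSpace_apply]

lemma conjSpace_smul (a : ℂ) (x : Space N) : conjSpace (a • x) = star a • conjSpace x := by
  ext i; simp [conjSpace_apply]

lemma conjSpace_zero : conjSpace (0 : Space N) = 0 := by
  ext i; simp [conjSpace_apply]

lemma opOmega_conjSpace (x : Space N) : S.opOmega (conjSpace x) = -conjSpace (S.opOmega x) := by
  ext i
  rw [PiLp.neg_apply, conjSpace_apply, opOmega, Matrix.ofLp_toLpLin, Matrix.toLin'_apply,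
    Matrix.ofLp_toLpLin, Matrix.toLin'_apply]
  simp only [Matrix.mulVec, dotProduct, star_sum, star_mul', S.star_omega_apply, conjSpace_apply]
  simp

lemma opB_conjSpace (x : Space N) : S.opB (conjSpace x) = conjSpace (S.opB x) := by
  ext i
  rw [conjSpace_apply, opB, Matrix.ofLp_toLpLin, Matrix.toLin'_apply, Matrix.ofLp_toLpLin,
    Matrix.toLin'_apply]
  simp only [Matrix.mulVec, dotProduct, star_sum, star_mul', S.star_B_apply, conjSpace_apply]

lemma projKerB_conjSpace (x : Space N) : S.projKerB (conjSpace x) = conjSpace (S.projKerB x) := by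
  refine S.projKerB_eq ?_ fun k hk ↦ ?_
  · rw [opB_conjSpace, opB_projKerB, conjSpace_zero]
  · rw [← conjSpace_sub, inner_conjSpace, S.inner_sub_projKerB, star_zero]
    rw [opB_conjSpace, hk, conjSpace_zero]

lemma compOmega_conjSpace (x : Space N) :
    S.compOmega (conjSpace x) = -conjSpace (S.compOmega x) := by
  simp only [compOmega_apply, projKerB_conjSpace, opOmega_conjSpace, map_neg]

/-- The conjugate of an eigenvector is an eigenvector for `-μ`, as `μ` is real. -/
lemma neg_mem_spectrum_of_conjSpace {T : Module.End ℂ (Space N)}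
    (hT : ∀ x, T (conjSpace x) = -conjSpace (T x)) {μ : ℝ} (hμ : (μ : ℂ) ∈ spectrum ℂ T) :
    ((-μ : ℝ) : ℂ) ∈ spectrum ℂ T := by
  rw [Module.End.mem_spectrum_iff_exists] at hμ ⊢
  obtain ⟨x, hx, h⟩ := hμ
  refine ⟨conjSpace x, conjSpace_ne_zero hx, ?_⟩
  rw [hT, h, conjSpace_smul]
  simp

/-! ### The constants `ω_max`, `b_min` and `ρ_min` -/

lemma finite_real_spectrum (T : Module.End ℂ (Space N)) :
    {μ : ℝ | (μ : ℂ) ∈ spectrum ℂ T}.Finite :=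
  T.spectrum_finite.preimage Complex.ofReal_injective.injOn

/-- `ω_max` bounds eigenvalues only from above; the symmetry of the spectrum makes it a bound on the
norm of `Ω`. -/
lemma abs_le_omegaMax {μ : ℝ} (h : (μ : ℂ) ∈ spectrum ℂ S.opOmega) : |μ| ≤ S.omegaMax := by
  have hb := (finite_real_spectrum S.opOmega).bddAbove
  have h' := neg_mem_spectrum_of_conjSpace S.opOmega_conjSpace h
  exact abs_le'.mpr ⟨le_csSup hb h, le_csSup hb h'⟩

lemma nontrivial_space (S : LagrangianSystem N) : Nontrivial (Space N) := by
  obtain ⟨x, hx⟩ := DFunLike.ne_iff.mp S.opB_ne_zero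
  exact nontrivial_of_ne _ _ hx

lemma omegaMax_nonneg : 0 ≤ S.omegaMax := by
  have := S.nontrivial_space
  obtain ⟨z, hz⟩ := spectrum.nonempty_of_isAlgClosed_of_finiteDimensional ℂ S.opOmega
  obtain ⟨μ, rfl⟩ := S.opOmega_isSymmetric.exists_ofReal_of_mem_spectrum hz
  exact (abs_nonneg _).trans (S.abs_le_omegaMax hz)

lemma norm_opOmega_le (x : Space N) : ‖S.opOmega x‖ ≤ S.omegaMax * ‖x‖ :=
  S.opOmega_isSymmetric.norm_apply_le S.omegaMax_nonneg (fun _ h ↦ S.abs_le_omegaMax h) x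

lemma norm_compOmega_le (x : Space N) : ‖S.compOmega x‖ ≤ S.omegaMax * ‖x‖ := by
  rw [compOmega_apply]
  refine (S.norm_projKerB_le _).trans ((S.norm_opOmega_le _).trans ?_)
  exact mul_le_mul_of_nonneg_left (S.norm_projKerB_le x) S.omegaMax_nonneg

lemma nonneg_of_mem_spectrum_opB {b : ℝ} (hb : (b : ℂ) ∈ spectrum ℂ S.opB) : 0 ≤ b :=
  eigenvalue_nonneg_of_nonneg (Module.End.hasEigenvalue_iff_mem_spectrum.mpr hb)
    fun x ↦ S.opB_isPositive.re_inner_nonneg_right x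

lemma bMin_mem : S.bMin ≠ 0 ∧ (S.bMin : ℂ) ∈ spectrum ℂ S.opB := by
  refine Set.Nonempty.csInf_mem (s := {b : ℝ | b ≠ 0 ∧ (b : ℂ) ∈ spectrum ℂ S.opB})
    (S.opB_isSymmetric.exists_ne_zero_mem_spectrum S.opB_ne_zero) ?_
  exact (finite_real_spectrum S.opB).subset fun _ h ↦ h.2

lemma bMin_pos : 0 < S.bMin :=
  lt_of_le_of_ne (S.nonneg_of_mem_spectrum_opB S.bMin_mem.2) S.bMin_mem.1.symm

lemma bMin_le {b : ℝ} (hb0 : b ≠ 0) (hb : (b : ℂ) ∈ spectrum ℂ S.opB) : S.bMin ≤ b :=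
  csInf_le ((finite_real_spectrum S.opB).subset fun _ h ↦ h.2).bddBelow ⟨hb0, hb⟩

lemma abs_le_omegaMax_of_mem_compOmega {ρ : ℝ} (h : (ρ : ℂ) ∈ spectrum ℂ S.compOmega) :
    |ρ| ≤ S.omegaMax := by
  obtain ⟨x, hx, hρ⟩ := (Module.End.mem_spectrum_iff_exists _ _).mp h
  have := S.norm_compOmega_le x
  rw [hρ, norm_smul, Complex.norm_real, Real.norm_eq_abs] at this
  exact le_of_mul_le_mul_right this (norm_pos_iff.mpr hx)

variable {S}

lemma rhoMin_mem (h : S.compOmega ≠ 0) :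
    0 < S.rhoMin ∧ (S.rhoMin : ℂ) ∈ spectrum ℂ S.compOmega := by
  refine Set.Nonempty.csInf_mem (s := {ρ : ℝ | 0 < ρ ∧ (ρ : ℂ) ∈ spectrum ℂ S.compOmega}) ?_ ?_
  · obtain ⟨ρ, hρ0, hρ⟩ := S.compOmega_isSymmetric.exists_ne_zero_mem_spectrum h
    rcases lt_or_gt_of_ne hρ0 with hlt | hgt
    · exact ⟨-ρ, neg_pos.mpr hlt, neg_mem_spectrum_of_conjSpace S.compOmega_conjSpace hρ⟩
    · exact ⟨ρ, hgt, hρ⟩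
  · exact (finite_real_spectrum S.compOmega).subset fun _ h ↦ h.2

lemma rhoMin_le_abs {ρ : ℝ} (h0 : ρ ≠ 0) (h : (ρ : ℂ) ∈ spectrum ℂ S.compOmega) :
    S.rhoMin ≤ |ρ| := by
  have hb : BddBelow {ρ : ℝ | 0 < ρ ∧ (ρ : ℂ) ∈ spectrum ℂ S.compOmega} := ⟨0, fun _ h ↦ h.1.le⟩
  refine csInf_le hb ⟨abs_pos.mpr h0, ?_⟩
  rcases abs_choice ρ with h' | h' <;> rw [h']
  · exact h
  · exact neg_mem_spectrum_of_conjSpace S.compOmega_conjSpace h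

lemma rhoMin_le_omegaMax (h : S.compOmega ≠ 0) : S.rhoMin ≤ S.omegaMax :=
  (le_abs_self _).trans (S.abs_le_omegaMax_of_mem_compOmega (rhoMin_mem h).2)

end LagrangianSystem

end

noncomputable section

namespace LagrangianSystem

open scoped InnerProductSpace

variable {N : ℕ} (S : LagrangianSystem N)

/-! ### Eigenvector estimates -/

lemma opA_apply (β : ℝ) (x : Space N) :
    S.opA β x = S.opOmega x - (Complex.I * (β : ℂ)) • S.opB x := rfl

/-- The part of `Ω` that couples `Ker B` and its orthogonal complement. -/
def coupling : Module.End ℂ (Space N) :=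
  S.projKerB * S.opOmega * (1 - S.projKerB) + (1 - S.projKerB) * S.opOmega * S.projKerB

/-- The operator `A(β)` with the coupling between `Ker B` and its orthogonal complement removed. -/
def opADecoupled (β : ℝ) : Module.End ℂ (Space N) := S.opA β - S.coupling

lemma coupling_apply (x : Space N) :
    S.coupling x = S.projKerB (S.opOmega (x - S.projKerB x)) +
      (S.opOmega (S.projKerB x) - S.projKerB (S.opOmega (S.projKerB x))) := rfl

/-- The vector `x - P x` is orthogonal to `Ker B`, so only eigenvalues of size at least `b_min`
contribute. -/
lemma bMin_mul_norm_le (x : Space N) :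
    S.bMin * ‖x - S.projKerB x‖ ≤ ‖S.opB x‖ := by
  have h := S.opB_isSymmetric.mul_norm_le_norm_smul_sub 1 0 S.bMin_pos.le (x - S.projKerB x)
    fun μ v hμ hv ↦ by
      by_cases h0 : μ = 0
      · right
        rw [h0, Complex.ofReal_zero, zero_smul] at hv
        rw [inner_eq_zero_symm]
        exact S.inner_sub_projKerB x hv
      · left
        have := S.bMin_le h0 hμ
        simpa using this.trans (le_abs_self μ)
  simpa [S.opB_projKerB] using h

/-- The central estimate: eliminating `u` costs one factor `ω_max / (β b_min - ω_max - ‖z‖)`, and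
its feedback into `Ker B` costs another `ω_max`. -/
lemma exists_near_mem_spectrum_compOmega {β : ℝ} (hβ : 0 ≤ β) {t : ℝ} (ht : t ∈ Set.Icc (0 : ℝ) 1)
    {z : ℂ} (hz : z ∈ spectrum ℂ (S.opADecoupled β + (t : ℂ) • S.coupling))
    (hg : 0 < β * S.bMin - S.omegaMax - ‖z‖) :
    ∃ ρ : ℝ, (ρ : ℂ) ∈ spectrum ℂ S.compOmega ∧
      ‖(ρ : ℂ) - z‖ ≤ S.omegaMax ^ 2 / (β * S.bMin - S.omegaMax - ‖z‖) := by
  obtain ⟨x, hx0, hx⟩ := (Module.End.mem_spectrum_iff_exists _ _).mp hz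
  have hω := S.omegaMax_nonneg
  have htn : ‖(t : ℂ)‖ ≤ 1 := by
    rw [Complex.norm_real, Real.norm_eq_abs, abs_of_nonneg ht.1]; exact ht.2
  have hx' : S.opOmega x - (Complex.I * (β : ℂ)) • S.opB x - S.coupling x +
      (t : ℂ) • S.coupling x = z • x := hx
  set y := S.projKerB x with hy
  set u := x - y with hu
  have hPy : S.projKerB y = y := S.projKerB_projKerB x
  have hxuy : x = u + y := by rw [hu]; abel
  have hFx : S.coupling x =
      S.projKerB (S.opOmega u) + (S.opOmega y - S.projKerB (S.opOmega y)) := S.coupling_apply x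
  have hWx : S.opOmega x = S.opOmega u + S.opOmega y := by rw [hxuy, map_add]
  have hCy : S.compOmega y = S.projKerB (S.opOmega y) := by rw [compOmega_apply, hPy]
  have hPF : S.projKerB (S.coupling x) = S.projKerB (S.opOmega u) := by
    rw [hFx, map_add, map_sub _ (S.opOmega y), S.projKerB_projKerB, S.projKerB_projKerB, sub_self,
      add_zero]
  -- Projecting onto `Ker B` removes the dissipative term.
  have h1 : S.compOmega y - z • y = -((t : ℂ) • S.projKerB (S.opOmega u)) := by
    have h := congrArg S.projKerB hx'
    rw [map_add, map_sub, map_sub, map_smul, map_smul, map_smul, S.projKerB_opB, hPF, hWx,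
      map_add, ← hy] at h
    rw [hCy, ← h, smul_zero]
    abel
  -- The complementary component of the eigenvalue equation.
  have h2 : (Complex.I * (β : ℂ)) • S.opB x =
      (S.opOmega u - S.projKerB (S.opOmega u)) - z • u +
        (t : ℂ) • (S.opOmega y - S.projKerB (S.opOmega y)) := by
    have h : z • x - z • S.projKerB x = z • u := by rw [← smul_sub]
    have h3 := congrArg S.projKerB hx'
    rw [map_add, map_sub, map_sub, map_smul, map_smul, map_smul, S.projKerB_opB, hPF, hWx,
      map_add] at h3
    rw [← h, ← h3, ← hx', hWx, hFx]
    module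
  have hBx : β * (S.bMin * ‖u‖) ≤ S.omegaMax * ‖u‖ + ‖z‖ * ‖u‖ + S.omegaMax * ‖y‖ := by
    have h3 : ‖(Complex.I * (β : ℂ)) • S.opB x‖ = β * ‖S.opB x‖ := by
      rw [norm_smul, norm_mul, Complex.norm_I, one_mul, Complex.norm_real, Real.norm_eq_abs,
        abs_of_nonneg hβ]
    calc β * (S.bMin * ‖u‖) ≤ β * ‖S.opB x‖ :=
          mul_le_mul_of_nonneg_left (S.bMin_mul_norm_le x) hβ
      _ = ‖(S.opOmega u - S.projKerB (S.opOmega u)) - z • u +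
        (t : ℂ) • (S.opOmega y - S.projKerB (S.opOmega y))‖ := by rw [← h3, h2]
      _ ≤ ‖S.opOmega u - S.projKerB (S.opOmega u)‖ + ‖z • u‖ +
          ‖(t : ℂ) • (S.opOmega y - S.projKerB (S.opOmega y))‖ :=
        (norm_add_le _ _).trans (add_le_add_left (norm_sub_le _ _) _)
      _ ≤ S.omegaMax * ‖u‖ + ‖z‖ * ‖u‖ + S.omegaMax * ‖y‖ := by
        rw [norm_smul, norm_smul]
        refine add_le_add (add_le_add ?_ le_rfl) ?_
        · exact (S.norm_sub_projKerB_le _).trans (S.norm_opOmega_le u)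
        · exact (mul_le_of_le_one_left (norm_nonneg _) htn).trans
            ((S.norm_sub_projKerB_le _).trans (S.norm_opOmega_le y))
  have hu_le : ‖u‖ ≤ S.omegaMax / (β * S.bMin - S.omegaMax - ‖z‖) * ‖y‖ := by
    rw [div_mul_eq_mul_div, le_div_iff₀ hg]
    nlinarith
  have hy0 : y ≠ 0 := by
    intro h
    rw [h, norm_zero, mul_zero] at hu_le
    exact hx0 (by rw [hxuy, h, norm_le_zero_iff.mp hu_le, add_zero])
  have hbound : ‖(1 : ℂ) • S.compOmega y - z • y‖ ≤
      S.omegaMax ^ 2 / (β * S.bMin - S.omegaMax - ‖z‖) * ‖y‖ := by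
    rw [one_smul, h1, norm_neg, norm_smul]
    calc ‖(t : ℂ)‖ * ‖S.projKerB (S.opOmega u)‖ ≤ ‖S.projKerB (S.opOmega u)‖ :=
          mul_le_of_le_one_left (norm_nonneg _) htn
      _ ≤ S.omegaMax * ‖u‖ := (S.norm_projKerB_le _).trans (S.norm_opOmega_le u)
      _ ≤ S.omegaMax * (S.omegaMax / (β * S.bMin - S.omegaMax - ‖z‖) * ‖y‖) :=
          mul_le_mul_of_nonneg_left hu_le hω
      _ = _ := by ring
  obtain ⟨ρ, hρ, h⟩ := S.compOmega_isSymmetric.exists_mem_spectrum_norm_le 1 z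
    (div_nonneg (sq_nonneg _) hg.le) hy0 hbound
  exact ⟨ρ, hρ, by rwa [one_mul] at h⟩

lemma decoupled_add_coupling (β : ℝ) : S.opADecoupled β + S.coupling = S.opA β :=
  sub_add_cancel _ _

/-- As `ρ ≠ 0`, the eigenvector lies in the range of the compression, hence in `Ker B`, where the
decoupled operator acts as the compression. -/
lemma mem_spectrum_opADecoupled (β : ℝ) {ρ : ℂ} (hρ0 : ρ ≠ 0)
    (hρ : ρ ∈ spectrum ℂ S.compOmega) : ρ ∈ spectrum ℂ (S.opADecoupled β) := by
  rw [Module.End.mem_spectrum_iff_exists] at hρ ⊢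
  obtain ⟨x, hx0, hx⟩ := hρ
  have hB : S.opB x = 0 := by
    have : S.opB (ρ • x) = 0 := by rw [← hx, compOmega_apply, S.opB_projKerB]
    rw [map_smul] at this
    exact (smul_eq_zero.mp this).resolve_left hρ0
  have hP : S.projKerB x = x := S.projKerB_of_opB_eq_zero hB
  refine ⟨x, hx0, ?_⟩
  rw [compOmega_apply, hP] at hx
  rw [opADecoupled, LinearMap.sub_apply, opA_apply, coupling_apply, hB, hP, hx]
  simp

/-- The eigenvalues of `A(β)` have nonpositive imaginary part. -/
lemma im_nonpos_of_mem_spectrum {β : ℝ} (hβ : 0 ≤ β) {z : ℂ} (hz : z ∈ spectrum ℂ (S.opA β)) :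
    z.im ≤ 0 := by
  obtain ⟨x, hx0, hx⟩ := (Module.End.mem_spectrum_iff_exists _ _).mp hz
  have h := congrArg (fun y ↦ (⟪x, y⟫_ℂ).im) hx
  have hΩ : (⟪x, S.opOmega x⟫_ℂ).im = 0 := by
    have := S.opOmega_isSymmetric.im_inner_self_apply x
    simpa using this
  have hB : 0 ≤ (⟪x, S.opB x⟫_ℂ).re := S.opB_isPositive.re_inner_nonneg_right x
  have hBim : (⟪x, S.opB x⟫_ℂ).im = 0 := by
    have := S.opB_isSymmetric.im_inner_self_apply x
    simpa using this
  have hxx : ⟪x, x⟫_ℂ = ((‖x‖ ^ 2 : ℝ) : ℂ) := by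
    rw [inner_self_eq_norm_sq_to_K]; simp
  simp only [opA_apply, inner_sub_right, inner_smul_right, hxx] at h
  rw [Complex.sub_im, hΩ, Complex.mul_im, Complex.im_mul_ofReal] at h
  simp only [Complex.mul_re, Complex.mul_im, Complex.I_re, Complex.I_im, Complex.ofReal_re,
    Complex.ofReal_im, hBim] at h
  have hpos : 0 < ‖x‖ ^ 2 := pow_pos (norm_pos_iff.mpr hx0) 2
  have : z.im * ‖x‖ ^ 2 ≤ 0 := by
    linarith [mul_nonneg hβ hB]
  by_contra hcon
  nlinarith [mul_pos (not_le.mp hcon) hpos]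

/-- Every eigenvalue of `A(β)` lies within `ω_max` of an eigenvalue of `-iβB`. -/
lemma spectrum_opA_subset (β : ℝ) :
    spectrum ℂ (S.opA β) ⊆ S.sigma0 β ∪ S.sigma1 β := by
  intro z hz
  obtain ⟨x, hx0, hx⟩ := (Module.End.mem_spectrum_iff_exists _ _).mp hz
  have h1 : (-(Complex.I * (β : ℂ))) • S.opB x - z • x = -S.opOmega x := by
    rw [← hx, opA_apply, neg_smul]; abel
  obtain ⟨b, hb, h⟩ := S.opB_isSymmetric.exists_mem_spectrum_norm_le (-(Complex.I * (β : ℂ))) z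
    S.omegaMax_nonneg hx0 (by rw [h1, norm_neg]; exact S.norm_opOmega_le x)
  by_cases hb0 : b = 0
  · refine Or.inl ⟨hz, ?_⟩
    simpa [hb0] using h
  · refine Or.inr ⟨hz, Set.mem_iUnion₂.mpr ⟨b, ⟨hb, by simpa using hb0⟩, ?_⟩⟩
    rw [Metric.mem_closedBall, dist_comm, dist_eq_norm, ← neg_mul]
    exact h

lemma le_neg_im_of_mem_sigma1 {β : ℝ} (hβ : 0 ≤ β) {z : ℂ} (hz : z ∈ S.sigma1 β) :
    β * S.bMin - S.omegaMax ≤ -z.im := by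
  obtain ⟨w, ⟨hw, hw0⟩, h⟩ := Set.mem_iUnion₂.mp hz.2
  obtain ⟨b, rfl⟩ := S.opB_isSymmetric.exists_ofReal_of_mem_spectrum hw
  have hb := S.bMin_le (by rintro rfl; simp at hw0) hw
  rw [Metric.mem_closedBall, dist_eq_norm] at h
  have h1 := (Complex.abs_im_le_norm _).trans h
  have h2 : (z - -(Complex.I * (β : ℂ) * (b : ℂ))).im = z.im + β * b := by simp
  rw [h2] at h1
  have := (abs_le.mp h1).2
  nlinarith [mul_le_mul_of_nonneg_left hb hβ]

/-! ### Consequences of the threshold on `β` -/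

variable {S}

/-- The inequalities that hold for `β` above the threshold `c⁻¹(ρ_min / 2)`. -/
structure ThresholdFacts (S : LagrangianSystem N) (β : ℝ) : Prop where
  nonneg : 0 ≤ β
  omegaMax_pos : 0 < S.omegaMax
  lt : 2 * S.omegaMax / S.bMin < β
  c_pos : 0 < S.c β
  c_mul : S.c β * (β * S.bMin - 2 * S.omegaMax) = 2 * S.omegaMax ^ 2
  two_mul_c_lt : 2 * S.c β < S.rhoMin
  gap : 4 * S.omegaMax < β * S.bMin - 2 * S.omegaMax
  rhoMin_pos : 0 < S.rhoMin
  rhoMin_le : S.rhoMin ≤ S.omegaMax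

lemma thresholdFacts (h : S.compOmega ≠ 0) {β : ℝ} (hβ : S.cInv (S.rhoMin / 2) < β) :
    ThresholdFacts S β := by
  have hb := S.bMin_pos
  have hρ := (rhoMin_mem h).1
  have hρω := rhoMin_le_omegaMax h
  have hω : 0 < S.omegaMax := hρ.trans_le hρω
  -- The threshold multiplied by `b_min`. It says `c(β) < ρ_min / 2`, and with `ρ_min ≤ ω_max` it
  -- yields the gap `4 ω_max`.
  have hg : 4 * S.omegaMax ^ 2 / S.rhoMin < β * S.bMin - 2 * S.omegaMax := by
    have : S.cInv (S.rhoMin / 2) * S.bMin = 4 * S.omegaMax ^ 2 / S.rhoMin + 2 * S.omegaMax := by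
      rw [cInv]; field_simp; ring
    nlinarith [mul_lt_mul_of_pos_right hβ hb]
  have hg0 : 0 < β * S.bMin - 2 * S.omegaMax := lt_trans (by positivity) hg
  have hc : S.c β = 2 * S.omegaMax ^ 2 / (β * S.bMin - 2 * S.omegaMax) := by
    have h1 : β - 2 * S.omegaMax / S.bMin = (β * S.bMin - 2 * S.omegaMax) / S.bMin := by
      field_simp
    rw [c, h1, inv_div, div_mul_div_comm, mul_comm S.bMin, mul_div_mul_right _ _ hb.ne']
  rw [div_lt_iff₀ hρ] at hg
  have hlt : 2 * S.omegaMax / S.bMin < β := by rw [div_lt_iff₀ hb]; linarith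
  refine ⟨le_trans (by positivity) hlt.le, hω, hlt, ?_, ?_, ?_, ?_, hρ, hρω⟩
  · rw [hc]; positivity
  · rw [hc]; field_simp
  · rw [hc, ← mul_div_assoc, div_lt_iff₀ hg0]; nlinarith
  · by_contra hcon
    nlinarith [mul_le_mul_of_nonneg_right (not_lt.mp hcon) hρ.le,
      mul_le_mul_of_nonneg_left hρω hω.le]

namespace ThresholdFacts

variable {β : ℝ}

/-- The range `‖z‖ ≤ ω_max + c` covers both `σ_0` and all the discs; the strict inequality is what
the homotopy argument needs. -/
lemma exists_near (H : ThresholdFacts S β) {t : ℝ} (ht : t ∈ Set.Icc (0 : ℝ) 1)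
    {z : ℂ} (hz : z ∈ spectrum ℂ (S.opADecoupled β + (t : ℂ) • S.coupling))
    (hzn : ‖z‖ ≤ S.omegaMax + S.c β) :
    ∃ ρ : ℝ, (ρ : ℂ) ∈ spectrum ℂ S.compOmega ∧ ‖(ρ : ℂ) - z‖ < S.c β := by
  have h1 := H.two_mul_c_lt
  have h2 := H.rhoMin_le
  have h3 := H.gap
  have h4 := H.omegaMax_pos
  have h5 := H.c_mul
  have h6 := H.c_pos
  have hg : 0 < β * S.bMin - S.omegaMax - ‖z‖ := by linarith
  obtain ⟨ρ, hρ, h⟩ := S.exists_near_mem_spectrum_compOmega H.nonneg ht hz hg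
  refine ⟨ρ, hρ, h.trans_lt ?_⟩
  rw [div_lt_iff₀ hg]
  -- Since `2‖z‖ < β b_min`, doubling the denominator exceeds `β b_min - 2 ω_max`, whose product
  -- with `c` is `2 ω_max²`.
  nlinarith [mul_lt_mul_of_pos_left (show (β * S.bMin - 2 * S.omegaMax) <
    2 * (β * S.bMin - S.omegaMax - ‖z‖) by linarith) h6]

/-- The union of the closed discs of radius `c(β)` about the nonzero eigenvalues of the
compression of `Ω`. -/
abbrev _root_.LagrangianSystem.discs (S : LagrangianSystem N) (β : ℝ) : Set ℂ :=
  ⋃ ρ ∈ spectrum ℂ S.compOmega \ {0}, Metric.closedBall ρ (S.c β)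

lemma exists_of_mem_discs {z : ℂ} (hz : z ∈ S.discs β) :
    ∃ ρ : ℝ, ρ ≠ 0 ∧ (ρ : ℂ) ∈ spectrum ℂ S.compOmega ∧ ‖z - ρ‖ ≤ S.c β := by
  obtain ⟨w, ⟨hw, hw0⟩, h⟩ := Set.mem_iUnion₂.mp hz
  obtain ⟨ρ, rfl⟩ := S.compOmega_isSymmetric.exists_ofReal_of_mem_spectrum hw
  exact ⟨ρ, by simpa using hw0, hw, by rwa [Metric.mem_closedBall, dist_eq_norm] at h⟩

lemma mem_discs {z : ℂ} {ρ : ℝ} (h0 : ρ ≠ 0) (hρ : (ρ : ℂ) ∈ spectrum ℂ S.compOmega)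
    (h : ‖z - ρ‖ ≤ S.c β) : z ∈ S.discs β :=
  Set.mem_iUnion₂.mpr ⟨ρ, ⟨hρ, by simpa using h0⟩, by rwa [Metric.mem_closedBall, dist_eq_norm]⟩

lemma rhoMin_sub_le_abs_re {z : ℂ} (hz : z ∈ S.discs β) : S.rhoMin - S.c β ≤ |z.re| := by
  obtain ⟨ρ, h0, hρ, h⟩ := exists_of_mem_discs hz
  have h1 := (Complex.abs_re_le_norm _).trans h
  rw [Complex.sub_re, Complex.ofReal_re] at h1
  have h2 := abs_sub_abs_le_abs_sub ρ z.re
  rw [abs_sub_comm] at h2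
  linarith [rhoMin_le_abs h0 hρ]

lemma abs_im_le {z : ℂ} (hz : z ∈ S.discs β) : |z.im| ≤ S.c β := by
  obtain ⟨ρ, h0, hρ, h⟩ := exists_of_mem_discs hz
  simpa using (Complex.abs_im_le_norm _).trans h

lemma norm_le {z : ℂ} (hz : z ∈ S.discs β) : ‖z‖ ≤ S.omegaMax + S.c β := by
  obtain ⟨ρ, h0, hρ, h⟩ := exists_of_mem_discs hz
  have h1 : ‖(ρ : ℂ)‖ ≤ S.omegaMax := by
    rw [Complex.norm_real, Real.norm_eq_abs]
    exact S.abs_le_omegaMax_of_mem_compOmega hρ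
  calc ‖z‖ = ‖(ρ : ℂ) + (z - ρ)‖ := by rw [add_sub_cancel]
    _ ≤ _ := (norm_add_le _ _).trans (add_le_add h1 h)

lemma disjoint_sigma (H : ThresholdFacts S β) : Disjoint (S.sigma0 β) (S.sigma1 β) := by
  rw [Set.disjoint_left]
  intro z h0 h1
  have := S.le_neg_im_of_mem_sigma1 H.nonneg h1
  have h2 := mem_closedBall_zero_iff.mp h0.2
  have h3 := (neg_le_abs _).trans ((Complex.abs_im_le_norm z).trans h2)
  linarith [H.gap, H.omegaMax_pos]

lemma mem_sigma0_of_neg_im_le (H : ThresholdFacts S β) {z : ℂ} (hz : z ∈ spectrum ℂ (S.opA β))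
    (h : -z.im ≤ S.c β) : z ∈ S.sigma0 β := by
  refine (S.spectrum_opA_subset β hz).resolve_right fun h1 ↦ ?_
  have := S.le_neg_im_of_mem_sigma1 H.nonneg h1
  linarith [H.gap, H.omegaMax_pos, H.two_mul_c_lt, H.rhoMin_le]

lemma mem_ball_or_mem_discs (H : ThresholdFacts S β) {z : ℂ} (hz : z ∈ S.sigma0 β) :
    z ∈ Metric.closedBall 0 (S.c β) ∨ z ∈ S.discs β := by
  have h2 := mem_closedBall_zero_iff.mp hz.2
  have hz1 : z ∈ spectrum ℂ (S.opADecoupled β + ((1 : ℝ) : ℂ) • S.coupling) := by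
    rw [Complex.ofReal_one, one_smul, decoupled_add_coupling]
    exact hz.1
  obtain ⟨ρ, hρ, h⟩ := H.exists_near (by simp) hz1 (by linarith [H.c_pos])
  rw [norm_sub_rev] at h
  by_cases h0 : ρ = 0
  · left
    rw [h0, Complex.ofReal_zero, sub_zero] at h
    exact mem_closedBall_zero_iff.mpr h.le
  · exact Or.inr (mem_discs h0 hρ h.le)

lemma disjoint_ball_discs (H : ThresholdFacts S β) :
    Disjoint (Metric.closedBall (0 : ℂ) (S.c β)) (S.discs β) := by
  rw [Set.disjoint_left]
  intro z h0 h1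
  have h2 := mem_closedBall_zero_iff.mp h0
  linarith [rhoMin_sub_le_abs_re h1, Complex.abs_re_le_norm z, H.two_mul_c_lt]

lemma sigma0_eq (H : ThresholdFacts S β) :
    S.sigma0 β = (spectrum ℂ (S.opA β) ∩ Metric.closedBall 0 (S.c β)) ∪
      (spectrum ℂ (S.opA β) ∩ S.discs β) := by
  ext z
  constructor
  · intro hz
    exact (H.mem_ball_or_mem_discs hz).imp (⟨hz.1, ·⟩) (⟨hz.1, ·⟩)
  · rintro (⟨hz, h⟩ | ⟨hz, h⟩)
    · refine ⟨hz, Metric.closedBall_subset_closedBall ?_ h⟩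
      linarith [H.two_mul_c_lt, H.rhoMin_le, H.c_pos]
    -- A disc about `ρ` may stick out of the disc of radius `ω_max`, so membership in `σ_0` comes
    -- from the small imaginary part.
    · exact H.mem_sigma0_of_neg_im_le hz ((neg_le_abs _).trans (abs_im_le h))

/-- The rectangle is larger than the disc, but an eigenvalue in it belongs to `σ_0`, and the discs
about nonzero `ρ` are excluded since `c < ρ_min - c`. -/
lemma spectrum_inter_ball (H : ThresholdFacts S β) :
    spectrum ℂ (S.opA β) ∩ Metric.closedBall 0 (S.c β) =
      {z | z ∈ spectrum ℂ (S.opA β) ∧ (0 ≤ -z.im ∧ -z.im ≤ S.c β) ∧ |z.re| ≤ S.c β} := by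
  ext z
  constructor
  · rintro ⟨hz, h⟩
    have h := mem_closedBall_zero_iff.mp h
    exact ⟨hz, ⟨neg_nonneg.mpr (S.im_nonpos_of_mem_spectrum H.nonneg hz),
      (neg_le_abs _).trans ((Complex.abs_im_le_norm z).trans h)⟩,
      (Complex.abs_re_le_norm z).trans h⟩
  · rintro ⟨hz, ⟨-, h1⟩, h2⟩
    refine ⟨hz, (H.mem_ball_or_mem_discs (H.mem_sigma0_of_neg_im_le hz h1)).resolve_right
      fun h ↦ ?_⟩
    linarith [rhoMin_sub_le_abs_re h, H.two_mul_c_lt]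

lemma spectrum_inter_discs (H : ThresholdFacts S β) :
    spectrum ℂ (S.opA β) ∩ S.discs β =
      {z | z ∈ spectrum ℂ (S.opA β) ∧ (0 ≤ -z.im ∧ -z.im ≤ S.c β) ∧
        S.rhoMin - S.c β ≤ |z.re|} := by
  ext z
  constructor
  · rintro ⟨hz, h⟩
    exact ⟨hz, ⟨neg_nonneg.mpr (S.im_nonpos_of_mem_spectrum H.nonneg hz),
      (neg_le_abs _).trans (abs_im_le h)⟩, rhoMin_sub_le_abs_re h⟩
  · rintro ⟨hz, ⟨-, h1⟩, h2⟩
    refine ⟨hz, (H.mem_ball_or_mem_discs (H.mem_sigma0_of_neg_im_le hz h1)).resolve_left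
      fun h ↦ ?_⟩
    linarith [mem_closedBall_zero_iff.mp h, Complex.abs_re_le_norm z, H.two_mul_c_lt]

/-- Homotopy from the decoupled operator, which has the eigenvalue `ρ_min`; eigenvalues in the
closed discs stay in the open ones. -/
lemma spectrum_inter_discs_nonempty (H : ThresholdFacts S β) (h : S.compOmega ≠ 0) :
    (spectrum ℂ (S.opA β) ∩ S.discs β).Nonempty := by
  have hfin : (spectrum ℂ S.compOmega \ {0}).Finite := S.compOmega.spectrum_finite.subset
    Set.sdiff_subset
  rw [← S.decoupled_add_coupling β]
  refine Module.End.exists_mem_spectrum_of_segment (S.opADecoupled β) S.coupling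
    (U := ⋃ ρ ∈ spectrum ℂ S.compOmega \ {0}, Metric.ball ρ (S.c β))
    (isOpen_biUnion fun _ _ ↦ Metric.isOpen_ball)
    (hfin.isCompact_biUnion fun ρ _ ↦ isCompact_closedBall ρ (S.c β))
    (Set.iUnion₂_mono fun _ _ ↦ Metric.ball_subset_closedBall) ?_ ?_
  · rintro t ht z ⟨hz, hzK⟩
    obtain ⟨ρ, hρ, hlt⟩ := H.exists_near ht hz (norm_le hzK)
    refine Set.mem_iUnion₂.mpr ⟨ρ, ⟨hρ, ?_⟩, ?_⟩
    · rintro h0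
      rw [Set.mem_singleton_iff] at h0
      rw [h0, zero_sub, norm_neg] at hlt
      linarith [rhoMin_sub_le_abs_re hzK, Complex.abs_re_le_norm z, H.two_mul_c_lt]
    · rwa [Metric.mem_ball, dist_comm, dist_eq_norm]
  · have hρ := rhoMin_mem h
    refine ⟨S.rhoMin, S.mem_spectrum_opADecoupled β (by simpa using hρ.1.ne') hρ.2,
      mem_discs hρ.1.ne' hρ.2 ?_⟩
    rw [sub_self, norm_zero]
    exact H.c_pos.le

/-! ### The modal dichotomy -/

/-- The modal dichotomy given by sums of generalized eigenspaces. -/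
def modalDichotomy (H : ThresholdFacts S β) : S.ModalDichotomy β where
  Hhl := (S.opA β).spectralSubspace (S.sigma1 β)
  Hll := (S.opA β).spectralSubspace (S.sigma0 β)
  Hll0 := (S.opA β).spectralSubspace (spectrum ℂ (S.opA β) ∩ Metric.closedBall 0 (S.c β))
  Hll1 := (S.opA β).spectralSubspace (spectrum ℂ (S.opA β) ∩ S.discs β)
  inv_hl := Module.End.spectralSubspace_invariant _ _
  inv_ll := Module.End.spectralSubspace_invariant _ _
  inv_ll0 := Module.End.spectralSubspace_invariant _ _
  inv_ll1 := Module.End.spectralSubspace_invariant _ _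
  isCompl_hl_ll := by
    refine ⟨Module.End.disjoint_spectralSubspace _ H.disjoint_sigma.symm, ?_⟩
    rw [codisjoint_iff, ← Module.End.spectralSubspace_union, Set.union_comm]
    exact Module.End.spectralSubspace_eq_top _ (S.spectrum_opA_subset β)
  spectrum_ll := by
    rw [Module.End.spectrum_restrict_spectralSubspace]
    exact Set.inter_eq_right.mpr Set.inter_subset_left
  spectrum_hl := by
    rw [Module.End.spectrum_restrict_spectralSubspace]
    exact Set.inter_eq_right.mpr Set.inter_subset_left
  disjoint_ll := Module.End.disjoint_spectralSubspace _
    (H.disjoint_ball_discs.mono Set.inter_subset_right Set.inter_subset_right)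
  sup_ll := by rw [← Module.End.spectralSubspace_union, ← H.sigma0_eq]
  spectrum_ll0 := by
    rw [Module.End.spectrum_restrict_spectralSubspace]
    exact Set.inter_eq_right.mpr Set.inter_subset_left
  spectrum_ll1 := by
    rw [Module.End.spectrum_restrict_spectralSubspace]
    exact Set.inter_eq_right.mpr Set.inter_subset_left

lemma modalDichotomy_unique (H : ThresholdFacts S β) (D : S.ModalDichotomy β) :
    D = H.modalDichotomy := by
  set D' := H.modalDichotomy with hD'
  have hhl : D.Hhl ≤ D'.Hhl := Module.End.le_spectralSubspace _ D.inv_hl D.spectrum_hl.subset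
  have hll : D.Hll ≤ D'.Hll := Module.End.le_spectralSubspace _ D.inv_ll D.spectrum_ll.subset
  have hll0 : D.Hll0 ≤ D'.Hll0 :=
    Module.End.le_spectralSubspace _ D.inv_ll0 D.spectrum_ll0.subset
  have hll1 : D.Hll1 ≤ D'.Hll1 :=
    Module.End.le_spectralSubspace _ D.inv_ll1 D.spectrum_ll1.subset
  -- By modularity, componentwise nested direct sums with equal total agree in each summand.
  have key : ∀ {a b a' b' : Submodule ℂ (Space N)}, a ≤ a' → b ≤ b' → a' ⊔ b' ≤ a ⊔ b →
      Disjoint a' b' → a = a' := by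
    intro a b a' b' ha hb hsup hd
    refine eq_of_le_of_inf_le_of_sup_le (z := b) ha ?_ ?_
    · rw [(hd.mono_right hb).eq_bot]; exact bot_le
    · exact (sup_le_sup_left hb a').trans hsup
  have e1 : D.Hhl = D'.Hhl := key hhl hll
    (by rw [D.isCompl_hl_ll.sup_eq_top]; exact le_top) D'.isCompl_hl_ll.disjoint
  have e2 : D.Hll = D'.Hll := key hll hhl
    (by rw [D.isCompl_hl_ll.symm.sup_eq_top]; exact le_top) D'.isCompl_hl_ll.symm.disjoint
  have e3 : D.Hll0 = D'.Hll0 := key hll0 hll1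
    (by rw [D.sup_ll, D'.sup_ll, e2]) D'.disjoint_ll
  have e4 : D.Hll1 = D'.Hll1 := key hll1 hll0
    (by rw [sup_comm, D'.sup_ll, sup_comm, D.sup_ll, e2]) D'.disjoint_ll.symm
  exact ModalDichotomy.ext e1 e2 e3 e4

lemma le_qFactor (H : ThresholdFacts S β) {z : ℂ} (hz : z ∈ spectrum ℂ (S.opA β) ∩ S.discs β) :
    ((1 / 2 * ((S.rhoMin - S.c β) / S.c β) : ℝ) : EReal) ≤ qFactor z := by
  have hre := rhoMin_sub_le_abs_re hz.2
  have him := abs_im_le hz.2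
  have hneg := S.im_nonpos_of_mem_spectrum H.nonneg hz.1
  have hc := H.c_pos
  have h2 := H.two_mul_c_lt
  -- The convention `Q_0 = 0` would break the bound; real nonzero `z` is harmless, with value `⊤`.
  have hz0 : z ≠ 0 := by
    rintro rfl
    rw [Complex.zero_re, abs_zero] at hre
    linarith
  rw [qFactor, if_neg hz0]
  split_ifs with h
  · exact le_top
  · refine EReal.coe_le_coe_iff.mpr (mul_le_mul_of_nonneg_left ?_ (by norm_num))
    have hpos : 0 < -z.im := neg_pos.mpr (lt_of_le_of_ne hneg h)
    exact div_le_div₀ (abs_nonneg _) hre hpos ((neg_le_abs _).trans him)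

end ThresholdFacts

end LagrangianSystem

end

/-! ### Assembly of the theorem. -/

open LagrangianSystem in
theorem mainTheorem10 {N : ℕ} (S : LagrangianSystem N)
    (hrank : S.R.rank < N) (hcomp : S.compOmega ≠ 0) :
    StrictAntiOn S.c (Set.Ioi (2 * S.omegaMax / S.bMin)) ∧
    Filter.Tendsto S.c Filter.atTop (nhds 0) ∧
    S.rhoMin / 2 ≤ S.omegaMax / 2 ∧
    (∀ β : ℝ, S.cInv (S.rhoMin / 2) < β →
      2 * S.omegaMax / S.bMin < β ∧
      max (S.c β) (S.rhoMin / 2) < S.rhoMin - S.c β ∧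
      Nonempty (S.ModalDichotomy β) ∧
      Subsingleton (S.ModalDichotomy β) ∧
      ∀ D : S.ModalDichotomy β,
        D.spec0 = {ζ | ζ ∈ spectrum ℂ (S.opA β) ∧
          (0 ≤ -ζ.im ∧ -ζ.im ≤ S.c β) ∧ |ζ.re| ≤ S.c β} ∧
        D.spec1 = {ζ | ζ ∈ spectrum ℂ (S.opA β) ∧
          (0 ≤ -ζ.im ∧ -ζ.im ≤ S.c β) ∧ S.rhoMin - S.c β ≤ |ζ.re|} ∧
        (∃ m : EReal, IsLeast (qFactor '' D.spec1) m ∧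
          ((1 / 2 * ((S.rhoMin - S.c β) / S.c β) : ℝ) : EReal) ≤ m) ∧
        1 / 4 * (S.rhoMin / S.c β) < 1 / 2 * ((S.rhoMin - S.c β) / S.c β) ∧
        1 / 2 ≤ 1 / 4 * (S.rhoMin / S.c β) ∧
        ∀ ζ ∈ D.spec1, ζ.re ≠ 0) ∧
    ∀ ζ : ℝ → ℂ,
      (∀ᶠ β in Filter.atTop, ∃ D : S.ModalDichotomy β, ζ β ∈ D.spec1) → IsUnderdamped ζ := by
  have hb := S.bMin_pos
  have hω : 0 < S.omegaMax := (rhoMin_mem hcomp).1.trans_le (rhoMin_le_omegaMax hcomp)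
  have hre : ∀ β : ℝ, S.cInv (S.rhoMin / 2) < β → ∀ D : S.ModalDichotomy β,
      ∀ ζ ∈ D.spec1, ζ.re ≠ 0 := by
    intro β hβ D ζ hζ h0
    have H := thresholdFacts hcomp hβ
    rw [ModalDichotomy.spec1, D.spectrum_ll1] at hζ
    have := ThresholdFacts.rhoMin_sub_le_abs_re hζ.2
    rw [h0, abs_zero] at this
    linarith [H.two_mul_c_lt, H.c_pos]
  refine ⟨?_, ?_, ?_, ?_, ?_⟩
  · intro x hx y hy hxy
    have hx' := sub_pos.mpr (Set.mem_Ioi.mp hx)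
    refine mul_lt_mul_of_pos_left ?_ (by positivity)
    exact inv_strictAnti₀ hx' (by linarith)
  · have h1 : Filter.Tendsto (fun β : ℝ ↦ (β - 2 * S.omegaMax / S.bMin)⁻¹) Filter.atTop
        (nhds 0) :=
      tendsto_inv_atTop_zero.comp (Filter.tendsto_atTop_add_const_right _ _ Filter.tendsto_id)
    have h2 := h1.const_mul (2 * S.omegaMax ^ 2 / S.bMin)
    rwa [mul_zero] at h2
  · linarith [rhoMin_le_omegaMax hcomp]
  · intro β hβ
    have H := thresholdFacts hcomp hβ
    have hc := H.c_pos
    have h2 := H.two_mul_c_lt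
    refine ⟨H.lt, max_lt (by linarith) (by linarith), ⟨H.modalDichotomy⟩,
      ⟨fun D D' ↦ (H.modalDichotomy_unique D).trans (H.modalDichotomy_unique D').symm⟩,
      fun D ↦ ⟨D.spectrum_ll0.trans H.spectrum_inter_ball,
        D.spectrum_ll1.trans H.spectrum_inter_discs, ?_, ?_, ?_, hre β hβ D⟩⟩
    · have hspec : D.spec1 = spectrum ℂ (S.opA β) ∩ S.discs β := D.spectrum_ll1
      rw [hspec]
      obtain ⟨z, hz, hmin⟩ := Set.exists_min_image _ qFactor
        ((S.opA β).spectrum_finite.inter_of_left (S.discs β))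
        (H.spectrum_inter_discs_nonempty hcomp)
      exact ⟨qFactor z, ⟨⟨z, hz, rfl⟩, Set.forall_mem_image.mpr hmin⟩, H.le_qFactor hz⟩
    -- This and the next bound both reduce to `2 c(β) < ρ_min`.
    · rw [← mul_div_assoc, ← mul_div_assoc, div_lt_div_iff_of_pos_right hc]
      linarith
    · rw [← mul_div_assoc, le_div_iff₀ hc]
      linarith
  · intro ζ hζ
    obtain ⟨β₀, hβ₀⟩ := Filter.eventually_atTop.mp hζ
    refine ⟨max 0 (max β₀ (S.cInv (S.rhoMin / 2))), le_max_left _ _, fun β hβ ↦ ?_⟩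
    obtain ⟨-, h1, h2⟩ := max_lt_iff.mp hβ |>.imp_right max_lt_iff.mp
    obtain ⟨D, hD⟩ := hβ₀ β h1.le
    exact hre β h2 D _ hD
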